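/- Let $\mathbb K$ be a commutative ring. Let $\mathbf B_n$ be the braid group on $n$ strands with Artin generators $\sigma_1,\dots,\sigma_{n-1}$ ($\mathbf B_0,\mathbf B_1$ trivial), $\mathbf F_n=\langle g_1,\dots,g_n\rangle$ the free group, $\natural$ the juxtaposition of braids, and $b_{n,m}=(\sigma_m\cdots\sigma_1)(\sigma_{m+1}\cdots\sigma_2)\cdots(\sigma_{n+m-1}\cdots\sigma_n)\in\mathbf B_{n+m}$ the braiding. For $m\le n$ let $\iota_{\mathbf F_{n-m}}*id_{\mathbf F_m}:\mathbf F_m\to\mathbf F_n$ be $g_i\mapsto g_{n-m+i}$ and $id_{\mathbf F_m}*\iota_{\mathbf F_{n-m}}:\mathbf F_m\to\mathbf F_n$ be $g_i\mapsto g_i$. **The category.** $\mathfrak U\boldsymbol\beta$ has objects the natural numbers. A morphism $n\to n'$ exists only if $n\le n'$, and is then a class $[n'-n,f]$ of elements $f\in\mathbf B_{n'}$, where $f'\circ(g\natural id_n)$ and $f'$ are identified for all $g\in\mathbf B_{n'-n}$. Composition is $[n''-n',g]\circ[n'-n,f]=[n''-n,\,g\circ(id_{n''-n'}\natural f)]$,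 and $\sigma\in\mathbf B_n$ is identified with $[0,\sigma]$. The functor $x\natural-$ sends $n$ to $x+n$ and $[n'-n,f]$ to $id_x\natural[n'-n,f]=[n'-n,\,(id_x\natural f)\circ(b_{x,n'-n}^{-1}\natural id_n)]$. On $\mathbf{Fct}(\mathfrak U\boldsymbol\beta,\mathbb K\text{-}\mathfrak{Mod})$ the translation functor $\tau_x$ is precomposition with $x\natural-$. **The families.** Families of group morphisms $a_n:\mathbf B_n\to Aut(\mathbf F_n)$ and $\varsigma_n:\mathbf F_n\to\mathbf B_{n+1}$, $n\in\mathbb N$, are *coherent* if for all $n\le n'$, $g\in\mathbf F_n$, $\sigma\in\mathbf B_n$, $\sigma'\in\mathbf B_{n'-n}$: 1. $(id_1\natural[n'-n,id_{n'}])\circ\varsigma_n(g)=\varsigma_{n'}\big((\iota_{\mathbf F_{n'-n}}*id_{\mathbf F_n})(g)\big)\circ(id_1\natural[n'-n,id_{n'}])$ in $\mathfrak U\boldsymbol\beta$; 2. $(\iota_{\mathbf F_{n'-n}}*id_{\mathbf F_n})\circ a_n(\sigma)=a_{n'}(\sigma'\natural\sigma)\circ(\iota_{\mathbf F_{n'-n}}*id_{\mathbf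 F_n})$; 3. $(id_1\natural\sigma)\circ\varsigma_n(g)=\varsigma_n(a_n(\sigma)(g))\circ(id_1\natural\sigma)$ in $\mathbf B_{n+1}$. They are *reliable* if moreover, for all $n\le n'$ and $\sigma\in\mathbf B_n$: 4. $a_{1+n'}(b_{1,n'-n}^{-1}\natural id_n)\circ(\iota_{\mathbf F_{n'-n}}*id_{\mathbf F_{1+n}})\circ(id_{\mathbf F_1}*\iota_{\mathbf F_n})=id_{\mathbf F_1}*\iota_{\mathbf F_{n'}}$; 5. $a_{n'}(id_{n'-n}\natural\sigma)\circ(id_{\mathbf F_{n'-n}}*\iota_{\mathbf F_n})=id_{\mathbf F_{n'-n}}*\iota_{\mathbf F_n}$. **The Long-Moody functor.** For coherent families let $\mathcal I_{\mathbb K[\mathbf F_n]}$ be the augmentation ideal, and let $\mathbf F_n$ act on $F(n+1)$ through $F\circ\varsigma_n$. The endofunctor $\mathbf{LM}$ of $\mathbf{Fct}(\mathfrak U\boldsymbol\beta,\mathbb K\text{-}\mathfrak{Mod})$ is given by $\mathbf{LM}(F)(n)=\mathcal I_{\mathbb K[\mathbf F_n]}\otimes_{\mathbb K[\mathbf F_n]}F(n+1)$,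 by $\mathbf{LM}(F)([n'-n,\sigma])(i\otimes v)=a_{n'}(\sigma)\big((\iota_{\mathbf F_{n'-n}}*id_{\mathbf F_n})(i)\big)\otimes F(id_1\natural[n'-n,\sigma])(v)$ and by $\mathbf{LM}(\eta)_n=id\otimes\eta_{n+1}$, group morphisms being extended linearly to augmentation ideals. **Proposition.** For coherent reliable families $\{a_n\}$, $\{\varsigma_n\}$ there is a natural equivalence of endofunctors of $\mathbf{Fct}(\mathfrak U\boldsymbol\beta,\mathbb K\text{-}\mathfrak{Mod})$ $$\tau_1\circ\mathbf{LM}\;\cong\;\tau_2\oplus(\mathbf{LM}\circ\tau_1).$$ It can be chosen so that, for all $F$ and $n$, its inverse is given on the summand $\tau_2(F)(n)=F(n+2)$ by $v\mapsto(g_1-1)\otimes v$, and on the summand $(\mathbf{LM}\circ\tau_1)(F)(n)=\mathcal I_{\mathbb K[\mathbf F_n]}\otimes_{\mathbb K[\mathbf F_n]}F(n+2)$ by $i\otimes v\mapsto(\iota_{\mathbf F_1}*id_{\mathbf F_n})(i)\otimes F(b_{1,1}^{-1}\natural id_n)(v)$, with values in $\mathcal I_{\mathbb K[\mathbf F_{1+n}]}\otimes_{\mathbb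 K[\mathbf F_{1+n}]}F(n+2)=(\tau_1\circ\mathbf{LM})(F)(n)$. -/

import Mathlib

open CategoryTheory Limits
open scoped TensorProduct

universe u

noncomputable section

namespace LongMoody

/-! ### Braid groups

Artin generators are indexed from `0`: the generator with index `i` is the one usually written
`σ_{i+1}`. The product `f * g` in a braid group is the composite `f ∘ g`. -/

/-- The Artin relations on the generators `σ_i`, `i + 1 < n`. -/
def braidRels (n : ℕ) : Set (FreeGroup {i : ℕ // i + 1 < n}) :=
  {r | (∃ i j : {i : ℕ // i + 1 < n}, j.1 = i.1 + 1 ∧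
        r = (FreeGroup.of i * FreeGroup.of j * FreeGroup.of i) *
          (FreeGroup.of j * FreeGroup.of i * FreeGroup.of j)⁻¹) ∨
      (∃ i j : {i : ℕ // i + 1 < n}, i.1 + 2 ≤ j.1 ∧
        r = (FreeGroup.of i * FreeGroup.of j) * (FreeGroup.of j * FreeGroup.of i)⁻¹)}

/-- The braid group on `n` strands. -/
abbrev BraidGroup (n : ℕ) : Type := PresentedGroup (braidRels n)

/-- The Artin generator with index `i` (used only for `i + 1 < n`). -/
def gen (n i : ℕ) : BraidGroup n :=
  if h : i + 1 < n then PresentedGroup.of ⟨i, h⟩ else 1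

lemma gen_of {n i : ℕ} (h : i + 1 < n) : gen n i = PresentedGroup.of ⟨i, h⟩ := dif_pos h

lemma gen_comm (n : ℕ) {i j : ℕ} (h : i + 2 ≤ j) : Commute (gen n i) (gen n j) := by
  unfold gen
  split_ifs with h1 h2
  · exact PresentedGroup.mk_eq_mk_of_mul_inv_mem (rels := braidRels n)
      (x := FreeGroup.of ⟨i, h1⟩ * FreeGroup.of ⟨j, h2⟩)
      (y := FreeGroup.of ⟨j, h2⟩ * FreeGroup.of ⟨i, h1⟩) (Or.inr ⟨⟨i, h1⟩, ⟨j, h2⟩, h, rfl⟩)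
  all_goals simp

lemma gen_braid {n i : ℕ} (h : i + 2 < n) :
    gen n i * gen n (i + 1) * gen n i = gen n (i + 1) * gen n i * gen n (i + 1) := by
  have h1 : i + 1 < n := by omega
  rw [gen_of h1, gen_of (i := i + 1) h]
  exact PresentedGroup.mk_eq_mk_of_mul_inv_mem (rels := braidRels n)
      (x := FreeGroup.of ⟨i, h1⟩ * FreeGroup.of ⟨i + 1, h⟩ * FreeGroup.of ⟨i, h1⟩)
      (y := FreeGroup.of ⟨i + 1, h⟩ * FreeGroup.of ⟨i, h1⟩ * FreeGroup.of ⟨i + 1, h⟩)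
      (Or.inl ⟨⟨i, h1⟩, ⟨i + 1, h⟩, rfl, rfl⟩)

/-- `place k h x` is the braid `id_k ♮ x ♮ id_l` on `n = k + m + l` strands. -/
def place {m n : ℕ} (k : ℕ) (h : k + m ≤ n) : BraidGroup m →* BraidGroup n :=
  PresentedGroup.toGroup (f := fun i : {i : ℕ // i + 1 < m} => gen n (k + i.1)) (by
    rintro r (⟨i, j, hij, rfl⟩ | ⟨i, j, hij, rfl⟩)
    · have := j.2
      simp only [map_mul, map_inv, FreeGroup.lift_apply_of, hij, ← add_assoc]
      rw [gen_braid (by omega), mul_inv_cancel]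
    · simp only [map_mul, map_inv, FreeGroup.lift_apply_of]
      rw [(gen_comm n (i := k + i.1) (j := k + j.1) (by omega)).eq, mul_inv_cancel])

lemma place_gen {m n k i : ℕ} (h : k + m ≤ n) (hi : i + 1 < m) :
    place k h (gen m i) = gen n (k + i) := by
  rw [gen_of hi]; exact PresentedGroup.toGroup.of _

lemma braid_hom_ext {m : ℕ} {G : Type*} [Group G] {f g : BraidGroup m →* G}
    (h : ∀ i, i + 1 < m → f (gen m i) = g (gen m i)) : f = g := by
  refine PresentedGroup.ext fun i => ?_
  have := h i.1 i.2
  rwa [gen_of i.2] at this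

lemma place_place {l m n k j : ℕ} (h : k + m ≤ n) (h' : j + l ≤ m) (x : BraidGroup l) :
    place k h (place j h' x) = place (n := n) (k + j) (by omega) x := by
  refine DFunLike.congr_fun (f := (place k h).comp (place j h')) (braid_hom_ext fun i hi => ?_) x
  rw [MonoidHom.comp_apply, place_gen h' hi, place_gen h (by omega), place_gen _ hi, add_assoc]

lemma place_zero_self {n : ℕ} (h : 0 + n ≤ n) (x : BraidGroup n) : place 0 h x = x := by
  refine DFunLike.congr_fun (f := place 0 h) (g := MonoidHom.id _) (braid_hom_ext fun i hi => ?_) x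
  rw [place_gen h hi, zero_add, MonoidHom.id_apply]

/-- An intertwining relation holds on a braid group if it holds on the generators. -/
lemma intertwine {m : ℕ} {G : Type*} [Group G] (f g : BraidGroup m →* G) (c : G)
    (h : ∀ i, i + 1 < m → c * f (gen m i) = g (gen m i) * c) (x : BraidGroup m) :
    c * f x = g x * c := by
  have : ((MulAut.conj c).toMonoidHom.comp f) = g := braid_hom_ext fun i hi => by
    simp [h i hi]
  rw [← this]; simp

lemma place_commute {m l n k j : ℕ} (h : k + m ≤ n) (h' : j + l ≤ n) (hkj : k + m ≤ j)
    (x : BraidGroup m) (y : BraidGroup l) : Commute (place k h x) (place j h' y) := by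
  refine intertwine (place j h') (place j h') _ (fun i hi => ?_) y
  refine (intertwine (place k h) (place k h) _ (fun i' hi' => ?_) x).symm
  rw [place_gen h hi', place_gen h' hi]
  exact (gen_comm n (by omega)).symm

/-- The juxtaposition `x ♮ y` of two braids. -/
def juxt {k m n : ℕ} (h : k + m = n) (x : BraidGroup k) (y : BraidGroup m) : BraidGroup n :=
  place 0 (by omega) x * place k h.le y

/-- The descending product `σ_{j+k-1} ⋯ σ_{j+1} σ_j` of `k` generators. -/
def run (N j k : ℕ) : BraidGroup N :=
  ((List.range k).reverse.map fun i => gen N (j + i)).prod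

/-- The braiding `b_{n,m} : n ♮ m → m ♮ n`, that is, with generators indexed from `0`,
`(σ_{m-1} ⋯ σ_0) (σ_m ⋯ σ_1) ⋯ (σ_{n+m-2} ⋯ σ_{n-1})`. -/
def braiding (n m : ℕ) : BraidGroup (n + m) :=
  ((List.range n).map fun j => run (n + m) j m).prod

lemma run_zero (N j : ℕ) : run N j 0 = 1 := by simp [run]

lemma run_succ (N j k : ℕ) : run N j (k + 1) = gen N (j + k) * run N j k := by
  simp [run, List.range_succ]

lemma run_add (N j k l : ℕ) : run N j (k + l) = run N (j + k) l * run N j k := by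
  induction l with
  | zero => simp [run_zero]
  | succ l ih => rw [← add_assoc, run_succ, run_succ, ih, mul_assoc, add_assoc]

lemma place_run {m n k j r : ℕ} (h : k + m ≤ n) (hr : j + r < m) :
    place k h (run m j r) = run n (k + j) r := by
  induction r with
  | zero => simp [run_zero]
  | succ r ih =>
    rw [run_succ, run_succ, map_mul, ih (by omega), place_gen h (by omega), add_assoc]

lemma gen_run_comm_low (N : ℕ) {i j r : ℕ} (h : i + 2 ≤ j) : Commute (gen N i) (run N j r) := by
  induction r with
  | zero => simp [run_zero]
  | succ r ih => rw [run_succ]; exact (gen_comm N (by omega)).mul_right ih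

lemma gen_run_comm_high (N : ℕ) {i j r : ℕ} (h : j + r + 1 ≤ i) :
    Commute (gen N i) (run N j r) := by
  induction r with
  | zero => simp [run_zero]
  | succ r ih =>
    rw [run_succ]; exact (gen_comm N (by omega)).symm.mul_right (ih (by omega))

lemma run_run_comm (N : ℕ) {i j r s : ℕ} (h : i + r + 1 ≤ j) :
    Commute (run N i r) (run N j s) := by
  induction r with
  | zero => simp [run_zero]
  | succ r ih =>
    rw [run_succ]
    exact (gen_run_comm_low N (by omega)).mul_left (ih (by omega))

lemma run_gen (N : ℕ) {j k i : ℕ} (hi : i + 1 < k) (hN : j + k < N) :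
    run N j k * gen N (j + i + 1) = gen N (j + i) * run N j k := by
  obtain ⟨r, rfl⟩ : ∃ r, k = i + 2 + r := ⟨k - (i + 2), by omega⟩
  rw [run_add, show i + 2 = i + 1 + 1 from rfl, run_succ, run_succ]
  have h1 : Commute (gen N (j + i + 1)) (run N j i) := gen_run_comm_high N le_rfl
  have h2 : Commute (gen N (j + i)) (run N (j + (i + 1 + 1)) r) := gen_run_comm_low N (by omega)
  have h3 := gen_braid (n := N) (i := j + i) (by omega)
  rw [← add_assoc j i 1]
  calc _ = run N (j + (i + 1 + 1)) r * (gen N (j + i + 1) * gen N (j + i) *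
        (run N j i * gen N (j + i + 1))) := by simp only [mul_assoc]
    _ = run N (j + (i + 1 + 1)) r * (gen N (j + i + 1) * gen N (j + i) *
        gen N (j + i + 1)) * run N j i := by rw [← h1.eq]; simp only [mul_assoc]
    _ = (run N (j + (i + 1 + 1)) r * gen N (j + i)) * gen N (j + i + 1) * gen N (j + i) *
        run N j i := by rw [← h3]; simp only [mul_assoc]
    _ = _ := by rw [← h2.eq]; simp only [mul_assoc]

/-- The braiding on `x + k` strands, starting at position `c` among `N` strands. -/
def braidingAt (N c x k : ℕ) : BraidGroup N :=
  ((List.range x).map fun j => run N (c + j) k).prod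

lemma braidingAt_succ (N c x k : ℕ) :
    braidingAt N c (x + 1) k = braidingAt N c x k * run N (c + x) k := by
  simp [braidingAt, List.range_succ]

lemma braidingAt_zero (N c k : ℕ) : braidingAt N c 0 k = 1 := by simp [braidingAt]

lemma braidingAt_run_zero (N c x : ℕ) : braidingAt N c x 0 = 1 := by
  induction x with
  | zero => exact braidingAt_zero _ _ _
  | succ x ih => rw [braidingAt_succ, ih, run_zero, one_mul]

lemma place_braiding {N c x k : ℕ} (h : c + (x + k) ≤ N) :
    place c h (braiding x k) = braidingAt N c x k := by
  unfold braiding braidingAt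
  rw [map_list_prod, List.map_map]
  congr 1
  refine List.map_congr_left fun j hj => ?_
  have := List.mem_range.1 hj
  exact place_run h (by omega)

lemma braidingAt_add (N c x l k : ℕ) :
    braidingAt N c x (l + k) = braidingAt N (c + l) x k * braidingAt N c x l := by
  have key : ∀ (y s : ℕ), ∀ z ≤ y, Commute (braidingAt N c z l) (run N (c + l + y) s) := by
    intro y s z
    induction z with
    | zero => intro _; rw [braidingAt_zero]; exact Commute.one_left _
    | succ z ih =>
      intro hz
      rw [braidingAt_succ]
      exact (ih (by omega)).mul_left (run_run_comm N (by omega))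
  induction x with
  | zero => simp [braidingAt_zero]
  | succ x ih =>
    rw [braidingAt_succ, braidingAt_succ, braidingAt_succ, ih, run_add]
    have := (key x k x le_rfl).eq
    rw [show c + x + l = c + l + x by omega]
    calc _ = braidingAt N (c + l) x k * (braidingAt N c x l * run N (c + l + x) k) *
          run N (c + x) l := by simp only [mul_assoc]
      _ = _ := by rw [this]; simp only [mul_assoc]

lemma braidingAt_gen (N : ℕ) {x k i : ℕ} (hi : i + 1 < k) (hN : x + k ≤ N) :
    braidingAt N 0 x k * gen N (x + i) = gen N i * braidingAt N 0 x k := by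
  induction x with
  | zero => simp [braidingAt_zero]
  | succ x ih =>
    have := run_gen N (j := x) hi (by omega)
    rw [braidingAt_succ, zero_add, mul_assoc, show x + 1 + i = x + i + 1 by omega, this,
      ← mul_assoc, ih (by omega), mul_assoc]

/-- Naturality of the braiding in its second variable. -/
lemma braidingAt_natural {N x k : ℕ} (hN : x + k ≤ N) (y : BraidGroup k) :
    braidingAt N 0 x k * place x hN y =
      place (n := N) 0 (by omega) y * braidingAt N 0 x k := by
  refine intertwine (place x hN) (place 0 _) _ (fun i hi => ?_) y
  rw [place_gen _ hi, place_gen _ hi, braidingAt_gen N hi hN, zero_add]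

/-! ### Quillen's bracket construction on the braid groupoid -/

/-- The objects of `Uβ`: natural numbers. -/
@[ext] structure UBeta : Type where
  strands : ℕ

/-- The image of `g ↦ g ♮ id_n : B_{n'-n} → B_{n'}`. -/
def block (n n' : ℕ) : Subgroup (BraidGroup n') :=
  (place (m := n' - n) (n := n') 0 (by omega)).range

lemma mem_block {n n' m : ℕ} (h : m ≤ n' - n) (x : BraidGroup m) :
    place (n := n') 0 (by omega) x ∈ block n n' :=
  ⟨place 0 (by omega) x, place_place _ _ _⟩

/-- A morphism `n → n'` of `Uβ`: it exists only for `n ≤ n'`, and then it is a class `[n' - n, f]`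
of elements `f` of `B_{n'}`, where `f' ∘ (g ♮ id_n)` and `f'` are identified for all
`g ∈ B_{n'-n}`. -/
@[ext] structure UHom (n n' : ℕ) : Type where
  le : n ≤ n'
  cls : BraidGroup n' ⧸ block n n'

/-- The morphism `[n' - n, f]`. -/
def UHom.mk' {n n' : ℕ} (h : n ≤ n') (f : BraidGroup n') : UHom n n' :=
  ⟨h, QuotientGroup.mk f⟩

lemma UHom.mk'_surj {n n' : ℕ} (φ : UHom n n') : ∃ h f, φ = UHom.mk' h f := by
  obtain ⟨h, c⟩ := φ
  obtain ⟨f, rfl⟩ := QuotientGroup.mk_surjective c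
  exact ⟨h, f, rfl⟩

lemma UHom.mk'_eq {n n' : ℕ} (h : n ≤ n') {f f' : BraidGroup n'} :
    UHom.mk' h f = UHom.mk' h f' ↔ f⁻¹ * f' ∈ block n n' := by
  rw [← QuotientGroup.eq]
  exact ⟨fun e => congrArg UHom.cls e, fun e => UHom.ext e⟩

lemma UHom.mk'_mul {n n' m : ℕ} (h : n ≤ n') (f : BraidGroup n') (hm : m ≤ n' - n)
    (x : BraidGroup m) : UHom.mk' h (f * place 0 (by omega) x) = UHom.mk' h f :=
  ((UHom.mk'_eq h).2 (by simpa using mem_block hm x)).symm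

/-- The composite `[n'' - n', g] ∘ [n' - n, f] = [n'' - n, g ∘ (id_{n''-n'} ♮ f)]`. -/
def UHom.comp {n n' n'' : ℕ} (φ : UHom n n') (γ : UHom n' n'') : UHom n n'' where
  le := φ.le.trans γ.le
  cls := Quotient.liftOn₂' γ.cls φ.cls
    (fun g f => QuotientGroup.mk
      (g * place (n'' - n') (by have := γ.le; omega) f))
    (by
      have h1 := φ.le
      have h2 := γ.le
      intro g f g' f' hg hf
      rw [QuotientGroup.leftRel_apply] at hg hf
      obtain ⟨x, hx⟩ := hg
      obtain ⟨y, hy⟩ := hf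
      obtain rfl : g' = g * place 0 (by omega) x := by rw [hx]; group
      obtain rfl : f' = f * place 0 (by omega) y := by rw [hy]; group
      refine congrArg UHom.cls (?_ : UHom.mk' (h1.trans h2) _ = UHom.mk' (h1.trans h2) _)
      rw [map_mul, mul_assoc g, ← mul_assoc (place 0 _ x),
        (place_commute (n := n'') (k := 0) (j := n'' - n') (by omega) (by omega) (by omega)
          x f).eq, UHom.mk'_eq, place_place]
      have e : (g * place (n'' - n') (by omega) f)⁻¹ *
          (g * (place (n'' - n') (by omega) f * place 0 (by omega) x *
            place (n'' - n' + 0) (by omega) y)) =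
          place (n := n'') 0 (by omega) (place (n := n'' - n) 0 (by omega) x *
            place (n'' - n') (by omega) y) := by
        rw [map_mul, place_place, place_place]
        simp [mul_assoc]
      rw [e]
      exact mem_block le_rfl _)

lemma UHom.mk'_comp {n n' n'' : ℕ} (h : n ≤ n') (h' : n' ≤ n'') (f : BraidGroup n')
    (g : BraidGroup n'') :
    (UHom.mk' h f).comp (UHom.mk' h' g) =
      UHom.mk' (h.trans h') (g * place (n'' - n') (by omega) f) := rfl

lemma place_congr {m n k k' : ℕ} (e : k = k') (h : k + m ≤ n) (x : BraidGroup m) :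
    place k h x = place k' (e ▸ h) x := by subst e; rfl

instance : Category.{0} UBeta where
  Hom n n' := UHom n.strands n'.strands
  id n := UHom.mk' le_rfl 1
  comp φ γ := φ.comp γ
  id_comp φ := by
    obtain ⟨h, f, rfl⟩ := UHom.mk'_surj φ
    rw [UHom.mk'_comp]; simp
  comp_id φ := by
    obtain ⟨h, f, rfl⟩ := UHom.mk'_surj φ
    rw [UHom.mk'_comp, one_mul, place_congr (Nat.sub_self _), place_zero_self]
  assoc {n n' n'' n'''} φ γ δ := by
    obtain ⟨h, f, rfl⟩ := UHom.mk'_surj φ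
    obtain ⟨h', g, rfl⟩ := UHom.mk'_surj γ
    obtain ⟨h'', d, rfl⟩ := UHom.mk'_surj δ
    simp only [UHom.mk'_comp, map_mul, place_place, mul_assoc]
    rw [place_congr (k := n'''.strands - n''.strands + (n''.strands - n'.strands))
      (k' := n'''.strands - n'.strands) (by omega)]

/-- The morphism `[n' - n, f] : n → n'` of `Uβ`. -/
def UBeta.hom {n n' : ℕ} (h : n ≤ n') (f : BraidGroup n') : (⟨n⟩ : UBeta) ⟶ ⟨n'⟩ :=
  UHom.mk' h f

/-- A braid `f ∈ B_n` seen as the automorphism `[0, f]` of `n` in `Uβ`. -/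
def UBeta.ofBraid {n : ℕ} (f : BraidGroup n) : (⟨n⟩ : UBeta) ⟶ ⟨n⟩ :=
  UBeta.hom le_rfl f

lemma UBeta.hom_surj {n n' : UBeta} (φ : n ⟶ n') : ∃ h f, φ = UBeta.hom h f := UHom.mk'_surj φ

lemma UBeta.hom_comp {n n' n'' : ℕ} (h : n ≤ n') (h' : n' ≤ n'') (f : BraidGroup n')
    (g : BraidGroup n'') :
    UBeta.hom h f ≫ UBeta.hom h' g =
      UBeta.hom (h.trans h') (g * place (n'' - n') (by omega) f) := rfl

lemma UBeta.hom_ofBraid {n n' : ℕ} (h : n ≤ n') (f g : BraidGroup n') :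
    UBeta.hom h f ≫ UBeta.ofBraid g = UBeta.hom h (g * f) := by
  rw [UBeta.ofBraid, UBeta.hom_comp, place_congr (Nat.sub_self _), place_zero_self]

lemma UBeta.ofBraid_mul {n : ℕ} (f g : BraidGroup n) :
    UBeta.ofBraid (f * g) = UBeta.ofBraid g ≫ UBeta.ofBraid f :=
  (UBeta.hom_ofBraid le_rfl g f).symm

lemma UBeta.ofBraid_one (n : ℕ) : UBeta.ofBraid (1 : BraidGroup n) = 𝟙 _ := rfl

/-- Compatibility of `id_x ♮ -` with composition, on representatives. -/
lemma tensor_aux (x : ℕ) {n n' n'' : ℕ} (h : n ≤ n') (h' : n' ≤ n'') (f : BraidGroup n')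
    (g : BraidGroup n'') :
    UHom.mk' (n := n + x) (n' := n'' + x) (by omega)
      (place x (by omega) (g * place (n'' - n') (by omega) f) *
        (place (n := n'' + x) 0 (by omega) (braiding x (n'' - n)))⁻¹) =
    (UHom.mk' (n := n + x) (n' := n' + x) (by omega) (place x (by omega) f *
        (place (n := n' + x) 0 (by omega) (braiding x (n' - n)))⁻¹)).comp
      (UHom.mk' (n' := n'' + x) (by omega) (place x (by omega) g *
        (place (n := n'' + x) 0 (by omega) (braiding x (n'' - n')))⁻¹)) := by
  rw [UHom.mk'_comp]
  congr 1
  have c := place_commute (n := n'' + x) (k := 0) (j := x + (n'' - n')) (by omega) (by omega)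
    (by omega) (braiding x (n'' - n')) f
  have b := braidingAt_add (n'' + x) 0 x (n'' - n') (n' - n)
  rw [show (n'' - n') + (n' - n) = n'' - n by omega, zero_add] at b
  rw [map_mul, map_mul, map_inv, place_place, place_place, place_place,
    place_congr (k := n'' + x - (n' + x) + x) (k' := x + (n'' - n')) (by omega),
    place_congr (k := n'' + x - (n' + x) + 0) (k' := n'' - n') (by omega)]
  simp only [place_braiding] at c ⊢
  rw [b, mul_inv_rev, mul_assoc, mul_assoc, ← mul_assoc (place _ _ f), ← c.inv_left.eq]
  simp only [mul_assoc]

/-- The map `[n' - n, f] ↦ id_x ♮ [n' - n, f] = [n' - n, (id_x ♮ f) ∘ ((b_{x,n'-n})⁻¹ ♮ id_n)]`. -/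
def tensorLeftMap (x : ℕ) {n n' : UBeta} (φ : n ⟶ n') :
    (⟨n.strands + x⟩ : UBeta) ⟶ ⟨n'.strands + x⟩ where
  le := Nat.add_le_add_right (UHom.le φ) x
  cls := Quotient.liftOn' (UHom.cls φ)
    (fun f => QuotientGroup.mk (place x (by omega) f *
      (place (n := n'.strands + x) 0 (by have := UHom.le φ; omega)
        (braiding x (n'.strands - n.strands)))⁻¹))
    (by
      have h := (UHom.le φ)
      intro f f' hf
      rw [QuotientGroup.leftRel_apply] at hf
      obtain ⟨y, hy⟩ := hf
      obtain rfl : f' = f * place 0 (by omega) y := by rw [hy]; group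
      refine congrArg UHom.cls
        (?_ : UHom.mk' (n := n.strands + x) (n' := n'.strands + x) (by omega) _ =
        UHom.mk' (n := n.strands + x) (n' := n'.strands + x) (by omega) _)
      have e := braidingAt_natural (N := n'.strands + x) (x := x) (by omega) y
      rw [map_mul, place_place, place_braiding, mul_assoc]
      have e' : place (n := n'.strands + x) (x + 0) (by omega) y *
          (braidingAt (n'.strands + x) 0 x (n'.strands - n.strands))⁻¹ =
          (braidingAt (n'.strands + x) 0 x (n'.strands - n.strands))⁻¹ *
            place 0 (by omega) y := by
        rw [mul_inv_eq_iff_eq_mul, mul_assoc, eq_inv_mul_iff_mul_eq]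
        exact e
      rw [e', ← mul_assoc, UHom.mk'_mul (n := n.strands + x) (n' := n'.strands + x) (by omega) _
        (by omega)])

lemma tensorLeftMap_hom (x : ℕ) {n n' : ℕ} (h : n ≤ n') (f : BraidGroup n') :
    tensorLeftMap x (UBeta.hom h f) =
      UBeta.hom (Nat.add_le_add_right h x) (place x (by omega) f *
        (place (n := n' + x) 0 (by omega) (braiding x (n' - n)))⁻¹) := rfl

/-- The functor `x ♮ - : Uβ → Uβ`. It sends `n` to `x ♮ n = n + x` and `φ` to `id_x ♮ φ`. -/
@[reducible] def tensorLeft (x : ℕ) : UBeta ⥤ UBeta where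
  obj n := ⟨n.strands + x⟩
  map φ := tensorLeftMap x φ
  map_id n := by
    refine (?_ : UHom.mk' _ _ = UHom.mk' _ _)
    rw [place_braiding, Nat.sub_self, braidingAt_run_zero, map_one, inv_one, one_mul]
  map_comp {n n' n''} φ γ := by
    obtain ⟨h, f, rfl⟩ := UBeta.hom_surj φ
    obtain ⟨h', g, rfl⟩ := UBeta.hom_surj γ
    obtain ⟨n⟩ := n
    obtain ⟨n'⟩ := n'
    obtain ⟨n''⟩ := n''
    replace h : n ≤ n' := h
    replace h' : n' ≤ n'' := h'
    refine tensor_aux x h h' f g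

/-! ### Coherent and reliable families

`F_n` is `FreeGroup (Fin n)`, with generators indexed from `0`. -/

/-- The morphism `F_m → F_n`, `g_i ↦ g_{k+i}`. For `k = n - m` it is `ι_{F_{n-m}} * id_{F_m}`
(the last `m` generators); for `k = 0` it is `id_{F_m} * ι_{F_{n-m}}` (the first `m`). -/
def freeIncl {m n : ℕ} (k : ℕ) (h : k + m ≤ n) : FreeGroup (Fin m) →* FreeGroup (Fin n) :=
  FreeGroup.map fun i => ⟨k + i.1, by omega⟩

/-- Coherent families `a_n : B_n → Aut(F_n)` and `ς_n : F_n → B_{n+1}`. -/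
structure IsCoherent (a : ∀ n : ℕ, BraidGroup n →* MulAut (FreeGroup (Fin n)))
    (ς : ∀ n : ℕ, FreeGroup (Fin n) →* BraidGroup (n + 1)) : Prop where
  /-- `(id_1 ♮ [n'-n, id]) ∘ ς_n(g) = ς_{n'}(e * g) ∘ (id_1 ♮ [n'-n, id])` in `Uβ`. -/
  stability : ∀ (n n' : ℕ) (h : n ≤ n') (g : FreeGroup (Fin n)),
    UBeta.ofBraid (ς n g) ≫ (tensorLeft 1).map (UBeta.hom h 1) =
      (tensorLeft 1).map (UBeta.hom h 1) ≫
        UBeta.ofBraid (ς n' (freeIncl (n' - n) (by omega) g))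
  /-- `(ι * id) ∘ a_n(σ) = a_{n'}(σ' ♮ σ) ∘ (ι * id)` as morphisms `F_n → F_{n'}`. -/
  action : ∀ (n n' : ℕ) (h : n ≤ n') (s : BraidGroup n) (s' : BraidGroup (n' - n))
    (g : FreeGroup (Fin n)),
    freeIncl (n' - n) (by omega) (a n s g) =
      a n' (juxt (Nat.sub_add_cancel h) s' s) (freeIncl (n' - n) (by omega) g)
  /-- `(id_1 ♮ σ) ∘ ς_n(g) = ς_n(a_n(σ)(g)) ∘ (id_1 ♮ σ)` in `B_{n+1}`. -/
  semidirect : ∀ (n : ℕ) (s : BraidGroup n) (g : FreeGroup (Fin n)),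
    place 1 (by omega) s * ς n g = ς n (a n s g) * place 1 (by omega) s

/-- The two further conditions on the actions `a_n` under which coherent families are called
reliable. -/
structure IsReliable (a : ∀ n : ℕ, BraidGroup n →* MulAut (FreeGroup (Fin n))) : Prop where
  /-- `a_{1+n'}((b_{1,n'-n})⁻¹ ♮ id_n) ∘ (ι_{F_{n'-n}} * id_{F_{1+n}}) ∘ (id_{F_1} * ι_{F_n})
  = id_{F_1} * ι_{F_{n'}}`. -/
  braiding_first : ∀ (n n' : ℕ) (_ : n ≤ n') (g : FreeGroup (Fin 1)),
    a (n' + 1) (place 0 (by omega) (braiding 1 (n' - n))⁻¹)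
      (freeIncl (m := n + 1) (n' - n) (by omega) (freeIncl 0 (by omega) g)) =
      freeIncl 0 (by omega) g
  /-- `a_{n'}(id_{n'-n} ♮ σ) ∘ (id_{F_{n'-n}} * ι_{F_n}) = id_{F_{n'-n}} * ι_{F_n}`. -/
  stabilizer : ∀ (n n' : ℕ) (_ : n ≤ n') (s : BraidGroup n) (g : FreeGroup (Fin (n' - n))),
    a n' (place (n' - n) (by omega) s) (freeIncl 0 (by omega) g) = freeIncl 0 (by omega) g

lemma freeIncl_freeIncl {l m n k j : ℕ} (h : k + m ≤ n) (h' : j + l ≤ m)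
    (g : FreeGroup (Fin l)) :
    freeIncl k h (freeIncl j h' g) = freeIncl (n := n) (k + j) (by omega) g := by
  refine DFunLike.congr_fun (f := (freeIncl k h).comp (freeIncl j h')) (FreeGroup.ext_hom _ _ ?_) g
  intro i
  simp [freeIncl, add_assoc]

lemma freeIncl_congr {m n k k' : ℕ} (e : k = k') (h : k + m ≤ n) :
    freeIncl k h = freeIncl k' (e ▸ h) := by subst e; rfl

lemma freeIncl_self {n : ℕ} (h : 0 + n ≤ n) : freeIncl 0 h = MonoidHom.id _ :=
  FreeGroup.ext_hom _ _ (by intro i; simp [freeIncl])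

section Action

variable {a : ∀ n : ℕ, BraidGroup n →* MulAut (FreeGroup (Fin n))}
  {ς : ∀ n : ℕ, FreeGroup (Fin n) →* BraidGroup (n + 1)}

lemma IsCoherent.action_left (hc : IsCoherent a ς) {n n' : ℕ} (h : n ≤ n') (y : BraidGroup (n' - n))
    (g : FreeGroup (Fin n)) :
    a n' (place 0 (by omega) y) (freeIncl (n' - n) (by omega) g) =
      freeIncl (n' - n) (by omega) g := by
  have := hc.action n n' h 1 y g
  simpa [juxt] using this.symm

lemma IsCoherent.action_right (hc : IsCoherent a ς) {n n' : ℕ} (h : n ≤ n') (s : BraidGroup n)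
    (g : FreeGroup (Fin n)) :
    a n' (place (n' - n) (by omega) s) (freeIncl (n' - n) (by omega) g) =
      freeIncl (n' - n) (by omega) (a n s g) := by
  have := hc.action n n' h s 1 g
  simpa [juxt] using this.symm

/-- The morphism `a_{n'}(σ) ∘ (ι_{F_{n'-n}} * id_{F_n}) : F_n → F_{n'}` attached to a morphism
`[n' - n, σ]` of `Uβ`. -/
def IsCoherent.freeMap (hc : IsCoherent a ς) {n n' : UBeta} (φ : n ⟶ n') :
    FreeGroup (Fin n.strands) →* FreeGroup (Fin n'.strands) :=
  Quotient.liftOn' (UHom.cls φ)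
    (fun f => (a n'.strands f).toMonoidHom.comp
      (freeIncl (n'.strands - n.strands) (by have := UHom.le φ; omega)))
    (by
      have h := UHom.le φ
      intro f f' hf
      rw [QuotientGroup.leftRel_apply] at hf
      obtain ⟨y, hy⟩ := hf
      obtain rfl : f' = f * place 0 (by omega) y := by rw [hy]; group
      ext1 i
      simp [hc.action_left h])

lemma IsCoherent.freeMap_hom (hc : IsCoherent a ς) {n n' : ℕ} (h : n ≤ n') (f : BraidGroup n')
    (g : FreeGroup (Fin n)) :
    hc.freeMap (UBeta.hom h f) g = a n' f (freeIncl (n' - n) (by omega) g) := rfl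

lemma IsCoherent.freeMap_id (hc : IsCoherent a ς) (n : UBeta) : hc.freeMap (𝟙 n) = MonoidHom.id _ := by
  ext1 i
  refine (hc.freeMap_hom le_rfl 1 _).trans ?_
  rw [freeIncl_congr (Nat.sub_self _), freeIncl_self]
  simp

lemma IsCoherent.freeMap_comp (hc : IsCoherent a ς) {n n' n'' : UBeta} (φ : n ⟶ n') (γ : n' ⟶ n'') :
    hc.freeMap (φ ≫ γ) = (hc.freeMap γ).comp (hc.freeMap φ) := by
  obtain ⟨h, f, rfl⟩ := UBeta.hom_surj φ
  obtain ⟨h', f', rfl⟩ := UBeta.hom_surj γ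
  obtain ⟨n⟩ := n
  obtain ⟨n'⟩ := n'
  obtain ⟨n''⟩ := n''
  simp only [] at h h' f f' ⊢
  refine MonoidHom.ext fun g => ?_
  rw [UBeta.hom_comp, MonoidHom.comp_apply]
  rw [hc.freeMap_hom, hc.freeMap_hom, hc.freeMap_hom, ← hc.action_right h', freeIncl_freeIncl,
    map_mul, MulAut.mul_apply, freeIncl_congr (k := n'' - n' + (n' - n)) (k' := n'' - n) (by omega)]

lemma IsCoherent.stability_hom (hc : IsCoherent a ς) {n n' : UBeta} (φ : n ⟶ n') (g : FreeGroup (Fin n.strands)) :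
    UBeta.ofBraid (ς n.strands g) ≫ (tensorLeft 1).map φ =
      (tensorLeft 1).map φ ≫ UBeta.ofBraid (ς n'.strands (hc.freeMap φ g)) := by
  obtain ⟨h, f, rfl⟩ := UBeta.hom_surj φ
  obtain ⟨n⟩ := n
  obtain ⟨n'⟩ := n'
  simp only [] at h f g ⊢
  replace h : n ≤ n' := h
  have e : (UBeta.hom h f) = UBeta.hom h 1 ≫ UBeta.ofBraid f := by
    rw [UBeta.hom_ofBraid, mul_one]
  have e' : tensorLeftMap 1 (UBeta.ofBraid f) =
      UBeta.ofBraid (n := n' + 1) (place 1 (by omega) f) := by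
    rw [UBeta.ofBraid, tensorLeftMap_hom, place_braiding, Nat.sub_self, braidingAt_run_zero,
      inv_one, mul_one]
    rfl
  have e'' := hc.semidirect n' f (freeIncl (n' - n) (by omega) g)
  have s := hc.stability n n' h g
  have m : tensorLeftMap 1 (UBeta.hom h f) =
      tensorLeftMap 1 (UBeta.hom h 1) ≫ UBeta.ofBraid (n := n' + 1) (place 1 (by omega) f) := by
    rw [e, ← e']
    exact (tensorLeft 1).map_comp _ _
  rw [hc.freeMap_hom]
  calc UBeta.ofBraid (ς n g) ≫ tensorLeftMap 1 (UBeta.hom h f)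
      = UBeta.ofBraid (ς n g) ≫ tensorLeftMap 1 (UBeta.hom h 1) ≫
          UBeta.ofBraid (n := n' + 1) (place 1 (by omega) f) := by rw [m]
    _ = (tensorLeftMap 1 (UBeta.hom h 1) ≫ UBeta.ofBraid (n := n' + 1)
          (ς n' (freeIncl (n' - n) (by omega) g))) ≫
          UBeta.ofBraid (n := n' + 1) (place 1 (by omega) f) := by
        rw [← Category.assoc]; exact congrArg (fun t => t ≫ _) s
    _ = tensorLeftMap 1 (UBeta.hom h 1) ≫ UBeta.ofBraid (n := n' + 1)
          (place 1 (by omega) f * ς n' (freeIncl (n' - n) (by omega) g)) := by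
        rw [Category.assoc, UBeta.ofBraid_mul]
    _ = tensorLeftMap 1 (UBeta.hom h f) ≫ UBeta.ofBraid (n := n' + 1)
          (ς n' (a n' f (freeIncl (n' - n) (by omega) g))) := by
        rw [e'', UBeta.ofBraid_mul, m, Category.assoc]

end Action

/-! ### Augmentation ideals and tensor products over group rings -/

section Aug

variable (K : Type u) [CommRing K]

/-- The augmentation `K[G] → K`, `g ↦ 1`. -/
def augmentation (G : Type) [Group G] : MonoidAlgebra K G →ₐ[K] K :=
  MonoidAlgebra.lift K K G 1

/-- The augmentation ideal of `K[G]`, the kernel of the augmentation. -/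
def augKer (G : Type) [Group G] : Submodule K (MonoidAlgebra K G) :=
  LinearMap.ker (augmentation K G).toLinearMap

/-- The augmentation ideal of `K[G]` as a type. -/
def AugIdeal (G : Type) [Group G] : Type u := augKer K G

instance (G : Type) [Group G] : AddCommGroup (AugIdeal K G) :=
  inferInstanceAs (AddCommGroup (augKer K G))

instance (G : Type) [Group G] : Module K (AugIdeal K G) :=
  inferInstanceAs (Module K (augKer K G))

variable {K} {G H L : Type} [Group G] [Group H] [Group L]

/-- The inclusion of the augmentation ideal in `K[G]`. -/
def AugIdeal.incl : AugIdeal K G →ₗ[K] MonoidAlgebra K G := (augKer K G).subtype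

@[ext] lemma AugIdeal.ext {i j : AugIdeal K G} (h : i.incl = j.incl) : i = j := Subtype.ext h

lemma AugIdeal.augmentation_incl (i : AugIdeal K G) : augmentation K G i.incl = 0 := i.2

lemma augmentation_single (g : G) (r : K) :
    augmentation K G (MonoidAlgebra.single g r) = r := by
  simp [augmentation]

/-- The element `g - 1` of the augmentation ideal. -/
def AugIdeal.sub_one (g : G) : AugIdeal K G :=
  ⟨MonoidAlgebra.single g 1 - 1, by
    simp [augKer, LinearMap.mem_ker, augmentation_single]⟩

/-- The right action of `K[G]` on the augmentation ideal, by multiplication. -/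
def AugIdeal.mulRight (i : AugIdeal K G) (r : MonoidAlgebra K G) : AugIdeal K G :=
  ⟨i.incl * r, by
    simp [augKer, LinearMap.mem_ker, i.augmentation_incl]⟩

/-- The map of augmentation ideals induced by a group morphism. -/
def AugIdeal.map (f : G →* H) : AugIdeal K G →ₗ[K] AugIdeal K H :=
  ((MonoidAlgebra.mapDomainAlgHom K K f).toLinearMap.comp AugIdeal.incl).codRestrict (augKer K H)
    (by
      have e : (augmentation K H).comp (MonoidAlgebra.mapDomainAlgHom K K f) =
          augmentation K G := by
        ext g; simp [augmentation]
      intro i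
      exact (DFunLike.congr_fun e i.incl).trans i.augmentation_incl)

lemma AugIdeal.incl_map (f : G →* H) (i : AugIdeal K G) :
    (AugIdeal.map f i).incl = MonoidAlgebra.mapDomainAlgHom K K f i.incl := rfl

lemma AugIdeal.map_id (i : AugIdeal K G) : AugIdeal.map (MonoidHom.id G) i = i := by
  refine AugIdeal.ext ?_
  rw [AugIdeal.incl_map]
  simp

lemma AugIdeal.map_comp (f : G →* H) (g : H →* L) (i : AugIdeal K G) :
    AugIdeal.map (g.comp f) i = AugIdeal.map g (AugIdeal.map f i) := by
  refine AugIdeal.ext ?_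
  simp only [AugIdeal.incl_map]
  rw [MonoidAlgebra.mapDomainAlgHom_comp]; rfl

lemma AugIdeal.map_mulRight (f : G →* H) (i : AugIdeal K G) (r : MonoidAlgebra K G) :
    AugIdeal.map f (i.mulRight r) =
      (AugIdeal.map f i).mulRight (MonoidAlgebra.mapDomainAlgHom K K f r) :=
  AugIdeal.ext (map_mul (MonoidAlgebra.mapDomainAlgHom K K f) i.incl r)

variable {V W X : Type u} [AddCommGroup V] [Module K V] [AddCommGroup W] [Module K W]
  [AddCommGroup X] [Module K X]

/-- The relations `(i · r) ⊗ v = i ⊗ (r · v)`, `r ∈ K[G]`. -/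
def balanced (ρ : Representation K G V) : Submodule K (AugIdeal K G ⊗[K] V) :=
  Submodule.span K {t | ∃ (i : AugIdeal K G) (r : MonoidAlgebra K G) (v : V),
    t = AugIdeal.mulRight i r ⊗ₜ[K] v - i ⊗ₜ[K] (ρ.asAlgebraHom r v)}

/-- The tensor product over `K[G]` of the augmentation ideal (a right `K[G]`-module) and the left
`K[G]`-module given by a representation `ρ` of `G`, as a `K`-module. -/
abbrev AugTensor (ρ : Representation K G V) : Type u := (AugIdeal K G ⊗[K] V) ⧸ balanced ρ

/-- The class of `i ⊗ v` in the tensor product over `K[G]`. -/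
def AugTensor.tmul (ρ : Representation K G V) (i : AugIdeal K G) (v : V) : AugTensor ρ :=
  (balanced ρ).mkQ (i ⊗ₜ[K] v)

/-- The map `i ⊗ v ↦ f(i) ⊗ h(v)` induced by a group morphism `f` and an `f`-equivariant
map `h`. -/
def AugTensor.map {ρ : Representation K G V} {θ : Representation K H W} (f : G →* H)
    (h : V →ₗ[K] W) (hfh : ∀ g v, h (ρ g v) = θ (f g) (h v)) :
    AugTensor ρ →ₗ[K] AugTensor θ :=
  Submodule.mapQ (balanced ρ) (balanced θ) (TensorProduct.map (AugIdeal.map f) h) (by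
    have key : ∀ (r : MonoidAlgebra K G) (v : V), h (ρ.asAlgebraHom r v) =
        θ.asAlgebraHom (MonoidAlgebra.mapDomainAlgHom K K f r) (h v) := by
      intro r v
      induction r using MonoidAlgebra.induction_on with
      | of g => simp [hfh]
      | add x y hx hy => simp only [map_add, LinearMap.add_apply, hx, hy]
      | smul c x hx => simp only [map_smul, LinearMap.smul_apply, hx]
    refine Submodule.span_le.2 ?_
    rintro _ ⟨i, r, v, rfl⟩
    refine Submodule.subset_span ⟨AugIdeal.map f i, MonoidAlgebra.mapDomainAlgHom K K f r, h v, ?_⟩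
    rw [map_sub, TensorProduct.map_tmul, TensorProduct.map_tmul, AugIdeal.map_mulRight, key])

lemma AugTensor.map_tmul {ρ : Representation K G V} {θ : Representation K H W} (f : G →* H)
    (h : V →ₗ[K] W) (hfh : ∀ g v, h (ρ g v) = θ (f g) (h v)) (i : AugIdeal K G) (v : V) :
    AugTensor.map f h hfh (AugTensor.tmul ρ i v) = AugTensor.tmul θ (AugIdeal.map f i) (h v) :=
  rfl

lemma AugTensor.hom_ext {ρ : Representation K G V} {f g : AugTensor ρ →ₗ[K] X}
    (h : ∀ i v, f (AugTensor.tmul ρ i v) = g (AugTensor.tmul ρ i v)) : f = g :=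
  Submodule.linearMap_qext _ (TensorProduct.ext' h)

end Aug

/-! ### Translation and Long-Moody functors -/

section LM

variable (K : Type u) [CommRing K]

/-- The category `Fct(Uβ, K-Mod)`. -/
abbrev Fct : Type _ := UBeta ⥤ ModuleCat.{u} K

/-- The translation functor `τ_x`: precomposition with `x ♮ -`. -/
def translation (x : ℕ) : Fct K ⥤ Fct K := (Functor.whiskeringLeft _ _ _).obj (tensorLeft x)

variable {K}

/-- The action of `F_n` on `F(n+1)` through `ς_n`. -/
def fiberRep (ς : ∀ n : ℕ, FreeGroup (Fin n) →* BraidGroup (n + 1)) (F : Fct K) (n : ℕ) :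
    Representation K (FreeGroup (Fin n)) (F.obj ⟨n + 1⟩) where
  toFun g := (F.map (UBeta.ofBraid (ς n g))).hom
  map_one' := by rw [map_one, UBeta.ofBraid_one, F.map_id]; rfl
  map_mul' g h := by rw [map_mul, UBeta.ofBraid_mul, F.map_comp]; rfl

variable {a : ∀ n : ℕ, BraidGroup n →* MulAut (FreeGroup (Fin n))}
  {ς : ∀ n : ℕ, FreeGroup (Fin n) →* BraidGroup (n + 1)}

/-- The functor `LM(F)`: `n` is sent to the tensor product over `K[F_n]` of the augmentation ideal
of `K[F_n]` with `F(n+1)`, and `[n' - n, σ]` to the map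
`i ⊗ v ↦ a_{n'}(σ)((ι_{F_{n'-n}} * id_{F_n})(i)) ⊗ F(id_1 ♮ [n' - n, σ])(v)`. -/
def longMoodyObj (hc : IsCoherent a ς) (F : Fct K) : Fct K where
  obj n := ModuleCat.of K (AugTensor (fiberRep ς F n.strands))
  map {n n'} φ := ModuleCat.ofHom (AugTensor.map (hc.freeMap φ)
    (F.map ((tensorLeft 1).map φ)).hom (fun g v => by
      have e := (F.map_comp _ _).symm.trans ((congrArg F.map (hc.stability_hom φ g)).trans
        (F.map_comp _ _))
      exact congrArg (fun t => t.hom v) e))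
  map_id n := by
    refine ModuleCat.hom_ext (AugTensor.hom_ext fun i v => ?_)
    change AugTensor.tmul (fiberRep ς F n.strands) (AugIdeal.map (hc.freeMap (𝟙 n)) i)
      ((F.map ((tensorLeft 1).map (𝟙 n))).hom v) = AugTensor.tmul (fiberRep ς F n.strands) i v
    rw [hc.freeMap_id, AugIdeal.map_id, (tensorLeft 1).map_id]
    exact congrArg (fun t => AugTensor.tmul (fiberRep ς F n.strands) i (t.hom v)) (F.map_id _)
  map_comp {n n' n''} φ γ := by
    refine ModuleCat.hom_ext (AugTensor.hom_ext fun i v => ?_)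
    change AugTensor.tmul (fiberRep ς F n''.strands) (AugIdeal.map (hc.freeMap (φ ≫ γ)) i)
      ((F.map ((tensorLeft 1).map (φ ≫ γ))).hom v) =
      AugTensor.tmul (fiberRep ς F n''.strands)
        (AugIdeal.map (hc.freeMap γ) (AugIdeal.map (hc.freeMap φ) i))
        ((F.map ((tensorLeft 1).map γ)).hom ((F.map ((tensorLeft 1).map φ)).hom v))
    rw [hc.freeMap_comp, AugIdeal.map_comp, (tensorLeft 1).map_comp, F.map_comp]
    rfl

variable (K) in
/-- The Long-Moody functor of coherent families; on a natural transformation `η` it is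
`id ⊗ η_{n+1}`. -/
def longMoody (hc : IsCoherent a ς) : Fct K ⥤ Fct K where
  obj F := longMoodyObj hc F
  map {F F'} η :=
    { app := fun n => ModuleCat.ofHom (AugTensor.map (MonoidHom.id _) (η.app ⟨n.strands + 1⟩).hom
        (fun g v => congrArg (fun t => t.hom v)
          (η.naturality (UBeta.ofBraid (ς n.strands g)))))
      naturality := fun n n' φ => by
        refine ModuleCat.hom_ext (AugTensor.hom_ext fun i v => ?_)
        have e := congrArg (fun t => t.hom v) (η.naturality ((tensorLeft 1).map φ))
        change AugTensor.tmul _ (AugIdeal.map _ (AugIdeal.map _ i)) _ =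
          AugTensor.tmul _ (AugIdeal.map _ (AugIdeal.map _ i)) _
        rw [AugIdeal.map_id, AugIdeal.map_id]
        exact congrArg (AugTensor.tmul _ _) e }
  map_id F := by
    ext n : 2
    refine ModuleCat.hom_ext (AugTensor.hom_ext fun i v => ?_)
    change AugTensor.tmul _ (AugIdeal.map _ i) _ = AugTensor.tmul _ i v
    rw [AugIdeal.map_id]
    rfl
  map_comp η θ := by
    ext n : 2
    refine ModuleCat.hom_ext (AugTensor.hom_ext fun i v => ?_)
    change AugTensor.tmul _ (AugIdeal.map _ i) _ =
      AugTensor.tmul _ (AugIdeal.map _ (AugIdeal.map _ i)) _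
    rw [AugIdeal.map_id, AugIdeal.map_id]
    rfl

end LM

end LongMoody

end

open LongMoody

noncomputable section

namespace LongMoody

/-! ### Augmentation ideals of free groups -/

section FreeAug

variable {K : Type u} [CommRing K] {G : Type} [Group G]
  {V X : Type u} [AddCommGroup V] [Module K V] [AddCommGroup X] [Module K X]

/-! The augmentation ideal of `K[F_{1+n}]` is a free right module on the elements `g_a - 1`. Hence
`I ⊗ V` is a sum of copies of `V`, one for each generator. The copy of `g_1` gives `F(n+2)`, and the
remaining ones assemble into `I_{K[F_n]} ⊗ V`, with `F_n` acting through the last `n` generators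
(`AugTensor.splitEquiv`).

Freeness is used as a universal property: a linear map out of `I ⊗ V` is determined by its values on
the `(g_a - 1) ⊗ v` (`AugTensor.hom_ext_of`), and these can be prescribed at will
(`AugTensor.desc`). Existence comes from extensions of `V` by a trivial representation, which over a
free group may be chosen generator by generator.

On `F(n+2)` the restricted action is through `ς_{n+1}`, whereas `LM(τ_1 F)` uses `id_1 ♮ ς_n`.
Condition 1 for `n → n+1` says that the crossing `b_{1,1}⁻¹ ♮ id_n` intertwines the two
(`IsCoherent.crossing_intertwine`), which explains its presence in the second summand.

Naturality in `n` of the first summand requires `1 ♮ φ` to fix `g_1`; this is reliability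
(`IsReliable.freeMap_tensorLeft_first`). For the second, `1 ♮ φ` must respect the last generators
(`IsCoherent.freeMap_tensorLeft`), and the crossing must commute with `2 ♮ φ`
(`tensorLeftMap_two_crossing`). Isomorphy is then a pointwise matter. -/

lemma AugIdeal.incl_sub_one (g : G) :
    (AugIdeal.sub_one g : AugIdeal K G).incl = MonoidAlgebra.single g 1 - 1 := rfl

lemma AugIdeal.map_sub_one {H : Type} [Group H] (f : G →* H) (g : G) :
    AugIdeal.map f (AugIdeal.sub_one g : AugIdeal K G) = AugIdeal.sub_one (f g) := by
  refine AugIdeal.ext ?_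
  rw [AugIdeal.incl_map, AugIdeal.incl_sub_one, AugIdeal.incl_sub_one, map_sub, map_one]
  simp

lemma AugTensor.tmul_add_left (ρ : Representation K G V) (i j : AugIdeal K G) (v : V) :
    AugTensor.tmul ρ (i + j) v = AugTensor.tmul ρ i v + AugTensor.tmul ρ j v := by
  simp only [AugTensor.tmul, TensorProduct.add_tmul, map_add]

lemma AugTensor.tmul_smul_left (ρ : Representation K G V) (c : K) (i : AugIdeal K G) (v : V) :
    AugTensor.tmul ρ (c • i) v = c • AugTensor.tmul ρ i v := by
  exact (balanced ρ).mkQ.map_smul c (i ⊗ₜ[K] v)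

lemma AugTensor.tmul_zero (ρ : Representation K G V) (i : AugIdeal K G) :
    AugTensor.tmul ρ i 0 = 0 := by
  simp only [AugTensor.tmul, TensorProduct.tmul_zero, map_zero]

/-- The linear map `v ↦ i ⊗ v`. -/
def AugTensor.tmulRight (ρ : Representation K G V) (i : AugIdeal K G) : V →ₗ[K] AugTensor ρ :=
  (balanced ρ).mkQ ∘ₗ TensorProduct.mk K (AugIdeal K G) V i

@[simp] lemma AugTensor.tmulRight_apply (ρ : Representation K G V) (i : AugIdeal K G) (v : V) :
    AugTensor.tmulRight ρ i v = AugTensor.tmul ρ i v := rfl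

lemma AugTensor.mulRight_tmul (ρ : Representation K G V) (i : AugIdeal K G)
    (r : MonoidAlgebra K G) (v : V) :
    AugTensor.tmul ρ (i.mulRight r) v = AugTensor.tmul ρ i (ρ.asAlgebraHom r v) := by
  refine sub_eq_zero.1 ?_
  rw [AugTensor.tmul, AugTensor.tmul, ← map_sub]
  exact (Submodule.Quotient.mk_eq_zero _).2 (Submodule.subset_span ⟨i, r, v, rfl⟩)

/-- The Fox rule `gh - 1 = (g - 1)h + (h - 1)`, with `h` moved across the tensor sign. It reduces
all group elements to generators. -/
lemma AugTensor.sub_one_mul (ρ : Representation K G V) (g h : G) (v : V) :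
    AugTensor.tmul ρ (AugIdeal.sub_one (g * h)) v =
      AugTensor.tmul ρ (AugIdeal.sub_one g) (ρ h v) + AugTensor.tmul ρ (AugIdeal.sub_one h) v := by
  have e : (AugIdeal.sub_one (g * h) : AugIdeal K G) =
      (AugIdeal.sub_one g).mulRight (MonoidAlgebra.single h 1) + AugIdeal.sub_one h := by
    refine AugIdeal.ext ?_
    change _ = (AugIdeal.sub_one g).incl * _ + (AugIdeal.sub_one h).incl
    simp only [AugIdeal.incl_sub_one, sub_mul, one_mul, MonoidAlgebra.single_mul_single, mul_one]
    abel
  rw [e, AugTensor.tmul_add_left, AugTensor.mulRight_tmul]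
  simp

/-- The augmentation ideal is spanned by the elements `g - 1`. -/
lemma AugIdeal.mem_span_sub_one (i : AugIdeal K G) :
    i ∈ Submodule.span K (Set.range (AugIdeal.sub_one : G → AugIdeal K G)) := by
  let P := (Submodule.span K (Set.range (AugIdeal.sub_one : G → AugIdeal K G))).map AugIdeal.incl
  -- The difference `r - ε(r)` is linear in `r`, so group elements suffice; on the augmentation
  -- ideal it equals `r`.
  have key : ∀ r : MonoidAlgebra K G, r - algebraMap K _ (augmentation K G r) ∈ P := by
    intro r
    induction r using MonoidAlgebra.induction_on with
    | of g =>
      refine ⟨AugIdeal.sub_one g, Submodule.subset_span ⟨g, rfl⟩, ?_⟩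
      rw [MonoidAlgebra.of_apply, augmentation_single, map_one, AugIdeal.incl_sub_one]
    | add x y hx hy =>
      have := P.add_mem hx hy
      rwa [sub_add_sub_comm, ← map_add, ← map_add] at this
    | smul c x hx =>
      rw [map_smul, smul_eq_mul, map_mul, ← Algebra.smul_def, ← smul_sub]
      exact P.smul_mem c hx
  obtain ⟨j, hj, e⟩ := key i.incl
  rw [i.augmentation_incl, map_zero, sub_zero] at e
  rwa [← AugIdeal.ext e]

lemma AugTensor.hom_ext_sub_one {ρ : Representation K G V} {f g : AugTensor ρ →ₗ[K] X}
    (h : ∀ x v, f (AugTensor.tmul ρ (AugIdeal.sub_one x) v) =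
      g (AugTensor.tmul ρ (AugIdeal.sub_one x) v)) : f = g := by
  refine AugTensor.hom_ext fun i v => ?_
  induction i.mem_span_sub_one using Submodule.span_induction with
  | mem _ hx => obtain ⟨x, rfl⟩ := hx; exact h x v
  | zero => simp [AugTensor.tmul]
  | add i j _ _ hi hj => simp only [AugTensor.tmul_add_left, map_add, hi, hj]
  | smul c i _ hi => simp only [AugTensor.tmul_smul_left, map_smul, hi]

/-! ### Freeness of the augmentation ideal of a free group -/

variable {α : Type}

/-- Over a free group, linear maps out of the tensor product are determined by their values on the
elements `(g_a - 1) ⊗ v`. -/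
lemma AugTensor.hom_ext_of {ρ : Representation K (FreeGroup α) V} {f g : AugTensor ρ →ₗ[K] X}
    (h : ∀ a v, f (AugTensor.tmul ρ (AugIdeal.sub_one (FreeGroup.of a)) v) =
      g (AugTensor.tmul ρ (AugIdeal.sub_one (FreeGroup.of a)) v)) : f = g := by
  have h1 : ∀ v, AugTensor.tmul ρ (AugIdeal.sub_one 1) v = 0 := fun v => by
    simpa using AugTensor.sub_one_mul ρ 1 1 v
  refine AugTensor.hom_ext_sub_one fun x => ?_
  induction x using FreeGroup.induction_on with
  | C1 => intro v; rw [h1, map_zero, map_zero]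
  | of a => exact h a
  | inv_of a ha =>
    intro v
    -- The Fox rule for `g_a g_a⁻¹ = 1` expresses `(g_a⁻¹ - 1) ⊗ v` as `-(g_a - 1) ⊗ g_a⁻¹ v`.
    have e := AugTensor.sub_one_mul ρ (FreeGroup.of a) (FreeGroup.of a)⁻¹ v
    rw [mul_inv_cancel, h1] at e
    rw [(neg_eq_of_add_eq_zero_right e.symm).symm, map_neg, map_neg, h]
  | mul x y hx hy =>
    intro v
    rw [AugTensor.sub_one_mul, map_add, map_add, hx, hy]

/-- The shear `(v, x) ↦ (φ v, x + d v)`. -/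
def shear (φ : V ≃ₗ[K] V) (d : V →ₗ[K] X) : (V × X) ≃ₗ[K] (V × X) :=
  LinearEquiv.ofLinearMap
    ((φ.toLinearMap ∘ₗ LinearMap.fst K V X).prod (LinearMap.snd K V X + d ∘ₗ LinearMap.fst K V X))
    ((φ.symm.toLinearMap ∘ₗ LinearMap.fst K V X).prod
      (LinearMap.snd K V X - d ∘ₗ φ.symm.toLinearMap ∘ₗ LinearMap.fst K V X))
    (by ext <;> simp) (by ext <;> simp)

/-- The extension of `ρ` by the trivial representation on `X` in which the generator `g_a` acts by
`(v, x) ↦ (ρ(g_a) v, x + d_a v)`. -/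
def extRep (ρ : Representation K (FreeGroup α) V) (d : α → V →ₗ[K] X) :
    Representation K (FreeGroup α) (V × X) :=
  (LinearEquiv.automorphismGroup.toLinearMapMonoidHom (R := K) (M := V × X)).comp
    -- Freeness of the group enters here: there are no relations to check, only invertibility of
    -- each generator's action.
    (FreeGroup.lift fun a => shear
      (LinearEquiv.ofLinearMap (ρ (FreeGroup.of a)) (ρ (FreeGroup.of a)⁻¹)
        (by ext; simp) (by ext; simp)) (d a))

lemma extRep_of (ρ : Representation K (FreeGroup α) V) (d : α → V →ₗ[K] X) (a : α) (p : V × X) :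
    extRep ρ d (FreeGroup.of a) p = (ρ (FreeGroup.of a) p.1, p.2 + d a p.1) := by
  simp only [extRep, MonoidHom.comp_apply, FreeGroup.lift_apply_of]
  rfl

lemma extRep_fst (ρ : Representation K (FreeGroup α) V) (d : α → V →ₗ[K] X) (g : FreeGroup α) :
    ∀ p : V × X, (extRep ρ d g p).1 = ρ g p.1 := by
  induction g using FreeGroup.induction_on with
  | C1 => simp
  | of a => simp [extRep_of]
  | inv_of a ha =>
    intro p
    have := ha (extRep ρ d (FreeGroup.of a)⁻¹ p)
    rw [Representation.self_inv_apply] at this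
    rw [this, Representation.inv_self_apply]
  | mul x y hx hy => simp [hx, hy]

lemma extRep_inr (ρ : Representation K (FreeGroup α) V) (d : α → V →ₗ[K] X) (g : FreeGroup α)
    (x : X) : extRep ρ d g (0, x) = (0, x) := by
  induction g using FreeGroup.induction_on with
  | C1 => simp
  | of a => simp [extRep_of]
  | inv_of a ha => rw [← ha, Representation.inv_self_apply, ha]
  | mul x y hx hy => simp [hx, hy]

lemma extRep_asAlgebraHom_fst (ρ : Representation K (FreeGroup α) V) (d : α → V →ₗ[K] X)
    (r : MonoidAlgebra K (FreeGroup α)) (p : V × X) :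
    ((extRep ρ d).asAlgebraHom r p).1 = ρ.asAlgebraHom r p.1 := by
  induction r using MonoidAlgebra.induction_on with
  | of g => simp [extRep_fst]
  | add x y hx hy => simp only [map_add, LinearMap.add_apply, Prod.fst_add, hx, hy]
  | smul c x hx => simp only [map_smul, LinearMap.smul_apply, Prod.smul_fst, hx]

/-- Since `X` is a trivial subrepresentation, `K[F]` acts on it through the augmentation. The
augmentation ideal therefore kills `X`, which is what makes `descAux` balanced. -/
lemma extRep_asAlgebraHom_inr (ρ : Representation K (FreeGroup α) V) (d : α → V →ₗ[K] X)
    (r : MonoidAlgebra K (FreeGroup α)) (x : X) :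
    (extRep ρ d).asAlgebraHom r (0, x) = (0, augmentation K (FreeGroup α) r • x) := by
  induction r using MonoidAlgebra.induction_on with
  | of g => simp [extRep_inr, augmentation_single]
  | add x y hx hy => simp [hx, hy, add_smul]
  | smul c x hx => simp [hx, mul_smul]

/-- The map `i ⊗ v ↦ pr₂ (i · (v, 0))`. -/
def descAux (ρ : Representation K (FreeGroup α) V) (d : α → V →ₗ[K] X) :
    AugIdeal K (FreeGroup α) →ₗ[K] V →ₗ[K] X :=
  LinearMap.compr₂ (LinearMap.compl₂
    (show AugIdeal K (FreeGroup α) →ₗ[K] (V × X) →ₗ[K] (V × X) from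
      (extRep ρ d).asAlgebraHom.toLinearMap ∘ₗ AugIdeal.incl) (LinearMap.inl K V X))
    (LinearMap.snd K V X)

lemma descAux_apply (ρ : Representation K (FreeGroup α) V) (d : α → V →ₗ[K] X)
    (i : AugIdeal K (FreeGroup α)) (v : V) :
    descAux ρ d i v = ((extRep ρ d).asAlgebraHom i.incl (v, 0)).2 := rfl

/-- Over a free group, linear maps out of the tensor product can be prescribed freely on the
elements `(g_a - 1) ⊗ v`. -/
def AugTensor.desc (ρ : Representation K (FreeGroup α) V) (d : α → V →ₗ[K] X) :
    AugTensor ρ →ₗ[K] X :=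
  (balanced ρ).liftQ (TensorProduct.lift (descAux ρ d)) (by
    refine Submodule.span_le.2 ?_
    rintro _ ⟨i, r, v, rfl⟩
    -- The vectors `r · (v, 0)` and `(r v, 0)` differ by an element of `X`, which `i` annihilates.
    have e : (extRep ρ d).asAlgebraHom r (v, 0) =
        (ρ.asAlgebraHom r v, 0) + (0, ((extRep ρ d).asAlgebraHom r (v, 0)).2) := by
      ext <;> simp [extRep_asAlgebraHom_fst]
    have e' : (i.mulRight r).incl = i.incl * r := rfl
    rw [SetLike.mem_coe, LinearMap.mem_ker, map_sub, TensorProduct.lift.tmul,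
      TensorProduct.lift.tmul, descAux_apply, descAux_apply, e', map_mul, Module.End.mul_apply, e,
      map_add, extRep_asAlgebraHom_inr, i.augmentation_incl]
    simp)

lemma AugTensor.desc_of (ρ : Representation K (FreeGroup α) V) (d : α → V →ₗ[K] X) (a : α)
    (v : V) : AugTensor.desc ρ d (AugTensor.tmul ρ (AugIdeal.sub_one (FreeGroup.of a)) v) =
      d a v := by
  change descAux ρ d _ v = _
  rw [descAux_apply, AugIdeal.incl_sub_one, map_sub, map_one]
  simp [extRep_of]

/-- The decomposition `I_{K[F_{n+1}]} ⊗ V = V ⊕ (I_{K[F_n]} ⊗ W)`, for `W` isomorphic to `V` as a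
representation of the free factor on the last `n` generators. -/
def AugTensor.splitEquiv {n : ℕ} {W : Type u} [AddCommGroup W] [Module K W]
    (ρ : Representation K (FreeGroup (Fin (n + 1))) V)
    (θ : Representation K (FreeGroup (Fin n)) W) (h : W ≃ₗ[K] V)
    (hh : ∀ g w, h.toLinearMap (θ g w) = ρ (freeIncl 1 (by omega) g) (h.toLinearMap w)) :
    (V × AugTensor θ) ≃ₗ[K] AugTensor ρ :=
  LinearEquiv.ofLinearMap
    ((AugTensor.tmulRight ρ (AugIdeal.sub_one (FreeGroup.of (0 : Fin (n + 1))))).coprod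
      (AugTensor.map (freeIncl 1 (by omega)) h.toLinearMap hh))
    -- The inverse sends `(g_1 - 1) ⊗ v` to `v` and `(g_{i+1} - 1) ⊗ v` to `(g_i - 1) ⊗ h⁻¹ v`. Both
    -- composites need checking only on such generators.
    (AugTensor.desc ρ (Fin.cons (LinearMap.inl K V (AugTensor θ)) fun i =>
      LinearMap.inr K V (AugTensor θ) ∘ₗ
        AugTensor.tmulRight θ (AugIdeal.sub_one (FreeGroup.of i)) ∘ₗ h.symm.toLinearMap))
    (by
      refine AugTensor.hom_ext_of fun i v => ?_
      rw [LinearMap.comp_apply, AugTensor.desc_of]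
      refine Fin.cases ?_ (fun j => ?_) i
      · simp
      · have e : freeIncl (n := n + 1) 1 (by omega) (FreeGroup.of j) = FreeGroup.of j.succ := by
          simp only [freeIncl, FreeGroup.map.of, add_comm 1]
          rfl
        simp [AugTensor.map_tmul, AugIdeal.map_sub_one, e, AugTensor.tmul_zero])
    (by
      refine LinearMap.prod_ext (LinearMap.ext fun v => ?_) (AugTensor.hom_ext_of fun j w => ?_)
      · simp [AugTensor.desc_of]
      · have e : freeIncl (n := n + 1) 1 (by omega) (FreeGroup.of j) = FreeGroup.of j.succ := by
          simp only [freeIncl, FreeGroup.map.of, add_comm 1]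
          rfl
        simp [AugTensor.map_tmul, AugIdeal.map_sub_one, e, AugTensor.desc_of])

end FreeAug

/-! ### Braids on one and two strands -/

instance : Subsingleton (BraidGroup 1) := by
  have h : MonoidHom.id (BraidGroup 1) = 1 := braid_hom_ext fun i hi => by omega
  exact ⟨fun x y => (DFunLike.congr_fun h x).trans (DFunLike.congr_fun h y).symm⟩

/-- The indeterminacy of a morphism `n → n + 1` is `B_1`, which is trivial. Identities between such
morphisms are thus identities of braids. -/
lemma block_succ (n : ℕ) : block n (n + 1) = ⊥ := by
  refine eq_bot_iff.2 ?_
  rintro _ ⟨x, rfl⟩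
  have : ∀ m, m = 1 → ∀ y : BraidGroup m, y = 1 := by
    rintro _ rfl y; exact Subsingleton.elim _ _
  rw [this _ (by omega) x, map_one]
  exact Subgroup.mem_bot.2 rfl

lemma UBeta.hom_eq {n n' : ℕ} (h : n ≤ n') {f f' : BraidGroup n'} :
    UBeta.hom h f = UBeta.hom h f' ↔ f⁻¹ * f' ∈ block n n' := UHom.mk'_eq h

lemma UBeta.hom_succ_injective (n : ℕ) {f f' : BraidGroup (n + 1)}
    (h : UBeta.hom n.le_succ f = UBeta.hom n.le_succ f') : f = f' := by
  rw [UBeta.hom_eq, block_succ, Subgroup.mem_bot] at h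
  exact inv_mul_eq_one.1 h

lemma braiding_one_one : braiding 1 1 = gen 2 0 := by
  simp [braiding, run]

/-! ### Iterated translation and naturality of the crossing -/

lemma tensorLeft_ofBraid (x : ℕ) {n : ℕ} (f : BraidGroup n) :
    (tensorLeft x).map (UBeta.ofBraid f) =
      UBeta.ofBraid (n := n + x) (place x (by omega) f) := by
  change tensorLeftMap x (UBeta.ofBraid f) = _
  rw [UBeta.ofBraid, tensorLeftMap_hom, place_braiding, Nat.sub_self, braidingAt_run_zero,
    inv_one, mul_one]
  rfl

lemma tensorLeftMap_hom_braidingAt (x : ℕ) {n n' : ℕ} (h : n ≤ n') (f : BraidGroup n') :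
    tensorLeftMap x (UBeta.hom h f) = UBeta.hom (n := n + x) (n' := n' + x) (by omega)
      (place x (by omega) f * (braidingAt (n' + x) 0 x (n' - n))⁻¹) := by
  rw [tensorLeftMap_hom, place_braiding]

/-- `1 ♮ (1 ♮ φ) = 2 ♮ φ`. -/
lemma tensorLeftMap_one_one {n n' : UBeta} (φ : n ⟶ n') :
    tensorLeftMap 1 (tensorLeftMap 1 φ) = tensorLeftMap 2 φ := by
  suffices H : ∀ (n n' : ℕ) (h : n ≤ n') (f : BraidGroup n'),
      tensorLeftMap 1 (tensorLeftMap 1 (UBeta.hom h f)) = tensorLeftMap 2 (UBeta.hom h f) by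
    obtain ⟨h, f, rfl⟩ := UBeta.hom_surj φ
    exact H _ _ h f
  intro n n' h f
  rw [tensorLeftMap_hom_braidingAt 2]
  refine (congrArg (tensorLeftMap 1) (tensorLeftMap_hom_braidingAt 1 h f)).trans
    ((tensorLeftMap_hom_braidingAt 1 (Nat.add_le_add_right h 1) _).trans ?_)
  refine congrArg (UBeta.hom (n := n + 2) (n' := n' + 2) (by omega)) ?_
  have e : n' + 1 - (n + 1) = n' - n := by omega
  -- The braiding of two strands past `k` is that of the second strand, followed by that of the
  -- first.
  have b : braidingAt (n' + 2) 0 2 (n' - n) =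
      braidingAt (n' + 2) 0 1 (n' - n) * braidingAt (n' + 2) 1 1 (n' - n) := by
    simp [braidingAt, List.range_succ]
  have p := place_braiding (N := n' + 1) (c := 0) (x := 1) (k := n' - n) (by omega)
  rw [e, ← p, map_mul, map_inv, place_place, place_place, place_braiding, b, mul_inv_rev,
    mul_assoc]

/-- Naturality of the braiding of a crossing of two strands with `k` strands. -/
lemma braidingAt_two_gen (N l k : ℕ) (h : l + k + 1 < N) :
    braidingAt N l 2 k * gen N l = gen N (l + k) * braidingAt N l 2 k := by
  induction k with
  | zero => simp [braidingAt_run_zero]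
  | succ k ih =>
    -- Passing one further strand contributes two generators; the inductive step is then a single
    -- braid relation.
    have e : braidingAt N l 2 (k + 1) = gen N (l + k) * gen N (l + k + 1) * braidingAt N l 2 k := by
      rw [braidingAt_add]
      simp [braidingAt, run, List.range_succ]
    rw [e, mul_assoc, ih (by omega), ← mul_assoc, gen_braid (by omega)]
    simp only [mul_assoc, add_assoc]

/-- The crossing of the first two strands is natural for the maps `2 ♮ φ`. -/
lemma tensorLeftMap_two_crossing {n n' : UBeta} (φ : n ⟶ n') :
    tensorLeftMap 2 φ ≫ UBeta.ofBraid (n := n'.strands + 2) (gen (n'.strands + 2) 0)⁻¹ =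
      UBeta.ofBraid (n := n.strands + 2) (gen (n.strands + 2) 0)⁻¹ ≫ tensorLeftMap 2 φ := by
  suffices H : ∀ (n n' : ℕ) (h : n ≤ n') (f : BraidGroup n'),
      tensorLeftMap 2 (UBeta.hom h f) ≫ UBeta.ofBraid (gen (n' + 2) 0)⁻¹ =
        UBeta.ofBraid (gen (n + 2) 0)⁻¹ ≫ tensorLeftMap 2 (UBeta.hom h f) by
    obtain ⟨h, f, rfl⟩ := UBeta.hom_surj φ
    exact H _ _ h f
  intro n n' h f
  rw [tensorLeftMap_hom_braidingAt, UBeta.hom_ofBraid, UBeta.ofBraid, UBeta.hom_comp]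
  refine congrArg (UBeta.hom (n := n + 2) (n' := n' + 2) (by omega)) ?_
  have c : Commute (gen (n' + 2) 0) (place (n := n' + 2) 2 (by omega) f) := by
    have := place_commute (n := n' + 2) (m := 2) (k := 0) (j := 2) (by omega) (by omega) le_rfl
      (gen 2 0) f
    rwa [place_gen _ (by omega)] at this
  have b := braidingAt_two_gen (n' + 2) 0 (n' - n) (by omega)
  -- Composition in `Uβ` shifts the crossing on the source by `n' - n` strands; the inverse braiding
  -- carries it back to the first two.
  have e : n' + 2 - (n + 2) + 0 = 0 + (n' - n) := by omega
  rw [map_inv, place_gen _ (by omega), e, ← mul_assoc, c.inv_left.eq, mul_assoc, mul_assoc,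
    ← mul_inv_rev, b, mul_inv_rev]

/-! ### The splitting -/

section Splitting

variable {K : Type u} [CommRing K]
  {a : ∀ n : ℕ, BraidGroup n →* MulAut (FreeGroup (Fin n))}
  {ς : ∀ n : ℕ, FreeGroup (Fin n) →* BraidGroup (n + 1)}

lemma braidingAt_one_one (N c : ℕ) : braidingAt N c 1 1 = gen N c := by
  simp [braidingAt, run]

/-- Condition 1 for `n → n + 1`, where `id_1 ♮ [1, id]` is `[1, b_{1,1}⁻¹ ♮ id_n]`. By `block_succ`
the equality of classes lifts to the braid group. -/
lemma IsCoherent.crossing_intertwine (hc : IsCoherent a ς) (n : ℕ) (g : FreeGroup (Fin n)) :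
    (gen (n + 2) 0)⁻¹ * place 1 (by omega) (ς n g) =
      ς (n + 1) (freeIncl 1 (by omega) g) * (gen (n + 2) 0)⁻¹ := by
  have s := hc.stability n (n + 1) n.le_succ g
  have t : tensorLeftMap 1 (UBeta.hom n.le_succ 1) =
      UBeta.hom (n := n + 1) (n' := n + 2) (by omega) (gen (n + 2) 0)⁻¹ := by
    rw [tensorLeftMap_hom_braidingAt, map_one, one_mul,
      show n.succ - n = 1 by omega, braidingAt_one_one]
  change _ ≫ tensorLeftMap 1 (UBeta.hom n.le_succ 1) =
    tensorLeftMap 1 (UBeta.hom n.le_succ 1) ≫ _ at s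
  rw [t] at s
  have s' := (UBeta.hom_comp _ _ _ _).symm.trans (s.trans (UBeta.hom_ofBraid _ _ _))
  have s'' := UBeta.hom_succ_injective (n + 1) s'
  rw [place_congr (k := n + 2 - (n + 1)) (k' := 1) (by omega),
    freeIncl_congr (k := n + 1 - n) (k' := 1) (by omega)] at s''
  exact s''

lemma IsCoherent.freeMap_tensorLeft_hom (hc : IsCoherent a ς) {n n' : ℕ} (h : n ≤ n')
    (f : BraidGroup n') (g : FreeGroup (Fin (n + 1))) :
    hc.freeMap (tensorLeftMap 1 (UBeta.hom h f)) g =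
      a (n' + 1) (place 1 (by omega) f) (a (n' + 1) (place 0 (by omega) (braiding 1 (n' - n))⁻¹)
        (freeIncl (n' - n) (by omega) g)) := by
  rw [tensorLeftMap_hom]
  refine (hc.freeMap_hom _ _ _).trans ?_
  rw [map_mul, MulAut.mul_apply, map_inv (place _ _),
    freeIncl_congr (k := n' + 1 - (n + 1)) (k' := n' - n) (by omega)]

/-- The braiding in `1 ♮ φ` involves only the first `1 + (n' - n)` strands, so by condition 2 it
fixes the last `n` generators; by the same condition `id_1 ♮ f` acts on the last `n'` generators as
`f` does. -/
lemma IsCoherent.freeMap_tensorLeft (hc : IsCoherent a ς) {n n' : UBeta} (φ : n ⟶ n')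
    (g : FreeGroup (Fin n.strands)) :
    hc.freeMap (tensorLeftMap 1 φ) (freeIncl (n := n.strands + 1) 1 (by omega) g) =
      freeIncl (n := n'.strands + 1) 1 (by omega) (hc.freeMap φ g) := by
  suffices H : ∀ (n n' : ℕ) (h : n ≤ n') (f : BraidGroup n') (g : FreeGroup (Fin n)),
      hc.freeMap (tensorLeftMap 1 (UBeta.hom h f)) (freeIncl (n := n + 1) 1 (by omega) g) =
        freeIncl (m := n') (n := n' + 1) 1 (by omega) (hc.freeMap (UBeta.hom h f) g) by
    obtain ⟨h, f, rfl⟩ := UBeta.hom_surj φ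
    exact H n.strands n'.strands h f g
  intro n n' h f g
  have l := hc.action_left (n := n) (n' := n' + 1) (by omega)
    -- This `place` only recasts the braid from `1 + (n' - n)` to `n' + 1 - n` strands.
    (place (m := 1 + (n' - n)) 0 (by omega) (braiding 1 (n' - n))⁻¹) g
  have r := hc.action_right (n := n') (n' := n' + 1) (by omega) f (freeIncl (n' - n) (by omega) g)
  rw [place_place, freeIncl_congr (k := n' + 1 - n) (k' := n' - n + 1) (by omega)] at l
  rw [place_congr (k := n' + 1 - n') (k' := 1) (by omega),
    freeIncl_congr (k := n' + 1 - n') (k' := 1) (by omega), freeIncl_freeIncl] at r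
  rw [hc.freeMap_tensorLeft_hom, hc.freeMap_hom, ← r, freeIncl_freeIncl,
    freeIncl_congr (k := 1 + (n' - n)) (k' := n' - n + 1) (by omega)]
  exact congrArg _ l

/-- Stabilization moves `g_1` to position `n' - n + 1`; the inverse braiding returns it to the front
by condition 4, and `id_1 ♮ f` fixes it by condition 5. -/
lemma IsReliable.freeMap_tensorLeft_first (hr : IsReliable a) (hc : IsCoherent a ς)
    {n n' : UBeta} (φ : n ⟶ n') :
    hc.freeMap (tensorLeftMap 1 φ) (FreeGroup.of (0 : Fin (n.strands + 1))) =
      FreeGroup.of (0 : Fin (n'.strands + 1)) := by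
  suffices H : ∀ (n n' : ℕ) (h : n ≤ n') (f : BraidGroup n'),
      hc.freeMap (tensorLeftMap 1 (UBeta.hom h f)) (FreeGroup.of (0 : Fin (n + 1))) =
        FreeGroup.of (0 : Fin (n' + 1)) by
    obtain ⟨h, f, rfl⟩ := UBeta.hom_surj φ
    exact H _ _ h f
  intro n n' h f
  have z : ∀ m, FreeGroup.of (0 : Fin (m + 1)) =
      freeIncl (m := 1) 0 (by omega) (FreeGroup.of 0) := fun m => by
    rw [freeIncl, FreeGroup.map.of]; rfl
  -- A variable `k` replaces `1` so that it can be identified with `n' + 1 - n'` inside the type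
  -- `Fin k`.
  have s : ∀ k (_ : k = 1) (hk : 0 + k ≤ n' + 1) (g : FreeGroup (Fin k)),
      n' + 1 - n' = k → a (n' + 1) (place 1 (by omega) f) (freeIncl 0 hk g) = freeIncl 0 hk g := by
    intro k hk hk' g e
    subst e
    have := hr.stabilizer n' (n' + 1) (by omega) f g
    rwa [place_congr (k := n' + 1 - n') (k' := 1) (by omega)] at this
  rw [hc.freeMap_tensorLeft_hom, z n, hr.braiding_first n n' h, s 1 rfl _ _ (by omega), z n']

/-! ### The two summands as natural transformations -/

lemma longMoodyObj_map_tmul (hc : IsCoherent a ς) (F : Fct K) {n n' : UBeta} (φ : n ⟶ n')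
    (i : AugIdeal K (FreeGroup (Fin n.strands))) (v : F.obj ⟨n.strands + 1⟩) :
    ((longMoodyObj hc F).map φ).hom (AugTensor.tmul (fiberRep ς F n.strands) i v) =
      AugTensor.tmul (fiberRep ς F n'.strands) (AugIdeal.map (hc.freeMap φ) i)
        ((F.map (tensorLeftMap 1 φ)).hom v) := rfl

variable (K) in
/-- The natural transformation `v ↦ (g_1 - 1) ⊗ v`. -/
def firstSummand (hc : IsCoherent a ς) (hr : IsReliable a) :
    translation K 2 ⟶ longMoody K hc ⋙ translation K 1 where
  app F :=
    { app := fun n => ModuleCat.ofHom (AugTensor.tmulRight (fiberRep ς F (n.strands + 1))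
        (AugIdeal.sub_one (FreeGroup.of (0 : Fin (n.strands + 1)))))
      naturality := fun n n' φ => by
        refine ModuleCat.hom_ext (LinearMap.ext fun v => ?_)
        refine Eq.trans ?_ (longMoodyObj_map_tmul hc F (tensorLeftMap 1 φ) _ v).symm
        rw [AugIdeal.map_sub_one, hr.freeMap_tensorLeft_first hc, tensorLeftMap_one_one]
        rfl }
  naturality F F' η := by
    ext n : 2
    refine ModuleCat.hom_ext (LinearMap.ext fun v => ?_)
    change AugTensor.tmul _ _ _ = AugTensor.tmul _ (AugIdeal.map _ _) _
    rw [AugIdeal.map_id]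
    rfl

/-- The image under `F` of `IsCoherent.crossing_intertwine`: the equivariance needed to define the
second summand on the tensor product over `K[F_n]`. -/
lemma fiberRep_crossing (hc : IsCoherent a ς) (F : Fct K) (n : ℕ) (g : FreeGroup (Fin n))
    (v : F.obj ⟨n + 2⟩) :
    (F.map (UBeta.ofBraid (n := n + 2) (gen (n + 2) 0)⁻¹)).hom
        (fiberRep ς ((translation K 1).obj F) n g v) =
      fiberRep ς F (n + 1) (freeIncl 1 (by omega) g)
        ((F.map (UBeta.ofBraid (n := n + 2) (gen (n + 2) 0)⁻¹)).hom v) := by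
  have e : (tensorLeft 1).map (UBeta.ofBraid (ς n g)) ≫
      UBeta.ofBraid (n := n + 2) (gen (n + 2) 0)⁻¹ =
      UBeta.ofBraid (n := n + 2) (gen (n + 2) 0)⁻¹ ≫
        UBeta.ofBraid (ς (n + 1) (freeIncl 1 (by omega) g)) := by
    rw [tensorLeft_ofBraid, ← UBeta.ofBraid_mul, ← UBeta.ofBraid_mul, hc.crossing_intertwine]
  exact congrArg (fun t => t.hom v)
    ((F.map_comp _ _).symm.trans ((congrArg F.map e).trans (F.map_comp _ _)))

variable (K) in
/-- The natural transformation `i ⊗ v ↦ (ι * id)(i) ⊗ F(b_{1,1}⁻¹ ♮ id_n)(v)`. -/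
def secondSummand (hc : IsCoherent a ς) :
    translation K 1 ⋙ longMoody K hc ⟶ longMoody K hc ⋙ translation K 1 where
  app F :=
    { app := fun n => ModuleCat.ofHom (AugTensor.map (freeIncl (n := n.strands + 1) 1 (by omega))
        (F.map (UBeta.ofBraid (n := n.strands + 2) (gen (n.strands + 2) 0)⁻¹)).hom
        (fiberRep_crossing hc F n.strands))
      naturality := fun n n' φ => by
        refine ModuleCat.hom_ext (AugTensor.hom_ext fun i v => ?_)
        refine Eq.trans ?_ (longMoodyObj_map_tmul hc F (tensorLeftMap 1 φ) _ _).symm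
        rw [← AugIdeal.map_comp]
        have e : (hc.freeMap (tensorLeftMap 1 φ)).comp
            (freeIncl (n := n.strands + 1) 1 (by omega)) =
            (freeIncl (n := n'.strands + 1) 1 (by omega)).comp (hc.freeMap φ) :=
          MonoidHom.ext fun g => hc.freeMap_tensorLeft φ g
        have c := tensorLeftMap_two_crossing φ
        rw [← tensorLeftMap_one_one] at c
        have c' := congrArg (fun t => t.hom v)
          ((F.map_comp _ _).symm.trans ((congrArg F.map c).trans (F.map_comp _ _)))
        rw [e, AugIdeal.map_comp]
        exact congrArg (AugTensor.tmul (fiberRep ς F (n'.strands + 1)) _) c' }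
  naturality F F' η := by
    ext n : 2
    refine ModuleCat.hom_ext (AugTensor.hom_ext fun i v => ?_)
    have e := congrArg (fun t => t.hom v)
      (η.naturality (UBeta.ofBraid (n := n.strands + 2) (gen (n.strands + 2) 0)⁻¹))
    change AugTensor.tmul _ (AugIdeal.map _ (AugIdeal.map _ i)) _ =
      AugTensor.tmul _ (AugIdeal.map _ (AugIdeal.map _ i)) _
    rw [AugIdeal.map_id, AugIdeal.map_id]
    exact congrArg (AugTensor.tmul _ _) e.symm

end Splitting

/-! ### Recognizing isomorphisms out of a biproduct -/

section Biprod

/-- A pair of linear maps that together form an isomorphism out of the product gives an isomorphism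
out of the biproduct. -/
lemma isIso_biprod_desc_of_bijective {K : Type u} [CommRing K] {M N P : ModuleCat.{u} K}
    (f : M ⟶ P) (g : N ⟶ P) (h : Function.Bijective (f.hom.coprod g.hom)) :
    IsIso (biprod.desc f g) := by
  have e : biprod.desc f g = (ModuleCat.biprodIsoProd M N).hom ≫
      ModuleCat.ofHom (f.hom.coprod g.hom) := by
    rw [← Iso.inv_comp_eq, biprod.desc_eq, Preadditive.comp_add, ← Category.assoc,
      ← Category.assoc, ModuleCat.biprodIsoProd_inv_comp_fst, ModuleCat.biprodIsoProd_inv_comp_snd]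
    rfl
  have : IsIso (ModuleCat.ofHom (f.hom.coprod g.hom)) :=
    (LinearEquiv.ofBijective _ h).toModuleIso.isIso_hom
  rw [e]
  infer_instance

/-- An additive functor preserves binary biproducts. It serves for evaluation at `F` and then at
`n`, where the biproduct becomes one of modules. -/
lemma isIso_map_biprod_desc {C D : Type*} [Category C] [Category D] [Preadditive C]
    [HasBinaryBiproducts C] [Preadditive D] [HasBinaryBiproducts D] (E : C ⥤ D) [E.Additive]
    {X Y Z : C} (f : X ⟶ Z) (g : Y ⟶ Z) (h : IsIso (biprod.desc (E.map f) (E.map g))) :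
    IsIso (E.map (biprod.desc f g)) := by
  have := preservesBinaryBiproducts_of_preservesBiproducts E
  rw [← biprod.mapBiprod_hom_desc]
  infer_instance

end Biprod

end LongMoody

end

/-! ### The natural equivalence -/

open LongMoody
theorem mainTheorem4 (K : Type u) [CommRing K]
    (a : ∀ n : ℕ, BraidGroup n →* MulAut (FreeGroup (Fin n)))
    (ς : ∀ n : ℕ, FreeGroup (Fin n) →* BraidGroup (n + 1))
    (hc : IsCoherent a ς) (hr : IsReliable a) :
    ∃ e : longMoody K hc ⋙ translation K 1 ≅
        translation K 2 ⊞ (translation K 1 ⋙ longMoody K hc),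
      ∀ (F : Fct K) (n : ℕ),
        (∀ v : F.obj ⟨n + 2⟩,
          (((biprod.inl ≫ e.inv).app F).app ⟨n⟩).hom v =
            AugTensor.tmul (fiberRep ς F (n + 1))
              (AugIdeal.sub_one (FreeGroup.of (0 : Fin (n + 1)))) v) ∧
        (∀ (i : AugIdeal K (FreeGroup (Fin n))) (v : F.obj ⟨n + 2⟩),
          (((biprod.inr ≫ e.inv).app F).app ⟨n⟩).hom
              (AugTensor.tmul (fiberRep ς ((translation K 1).obj F) n) i v) =
            AugTensor.tmul (fiberRep ς F (n + 1))
              (AugIdeal.map (freeIncl 1 (by omega)) i)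
              ((F.map (UBeta.ofBraid (place 0 (by omega) (braiding 1 1)⁻¹))).hom v)) := by
  let A := firstSummand K hc hr
  let B := secondSummand K hc
  have hpt : ∀ (F : Fct K) (n : UBeta),
      Function.Bijective (((A.app F).app n).hom.coprod ((B.app F).app n).hom) := by
    intro F n
    -- The crossing is invertible in `Uβ`, so `F` turns it into the linear equivalence required by
    -- `AugTensor.splitEquiv`, whose forward map is the coproduct map in question.
    let w : (⟨n.strands + 2⟩ : UBeta) ≅ ⟨n.strands + 2⟩ :=
      ⟨UBeta.ofBraid (gen (n.strands + 2) 0)⁻¹, UBeta.ofBraid (gen (n.strands + 2) 0),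
        by rw [← UBeta.ofBraid_mul, mul_inv_cancel, UBeta.ofBraid_one],
        by rw [← UBeta.ofBraid_mul, inv_mul_cancel, UBeta.ofBraid_one]⟩
    exact (AugTensor.splitEquiv (fiberRep ς F (n.strands + 1))
      (fiberRep ς ((translation K 1).obj F) n.strands) (F.mapIso w).toLinearEquiv
      (fiberRep_crossing hc F n.strands)).bijective
  have : IsIso (biprod.desc A B) := by
    -- Isomorphy is tested pointwise twice: at each `F` among endofunctors, then at each `n` among
    -- functors on `Uβ`.
    have : ∀ F, IsIso ((biprod.desc A B).app F) := fun F => by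
      have : ∀ n, IsIso (((biprod.desc A B).app F).app n) := fun n =>
        isIso_map_biprod_desc ((evaluation _ _).obj F ⋙ (evaluation _ _).obj n) A B
          (isIso_biprod_desc_of_bijective _ _ (hpt F n))
      exact NatIso.isIso_of_isIso_app _
    exact NatIso.isIso_of_isIso_app _
  refine ⟨(asIso (biprod.desc A B)).symm, fun F n => ⟨fun v => ?_, fun i v => ?_⟩⟩
  · have e : biprod.inl ≫ (asIso (biprod.desc A B)).symm.inv = A := by simp
    rw [e]
    rfl
  · have e : biprod.inr ≫ (asIso (biprod.desc A B)).symm.inv = B := by simp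
    rw [e, braiding_one_one, map_inv, place_gen _ (by omega)]
    rfl
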